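/- Well partial orders (wpos) are partial orders with no infinite bad sequence, i.e. every infinite sequence $x_1,x_2,\dots$ has $i<j$ with $x_i\le x_j$. For a wpo $X$, its maximal order type $o(X)$, height $h(X)$ and width $w(X)$ are the ranks (in the ordinals) of the empty sequence in the well-founded trees, ordered by inverse prefix order, of respectively the finite bad sequences ($x_i\not\le x_j$ for all $i<j$), the finite strictly decreasing sequences, and the finite antichains ($x_i,x_j$ incomparable for all $i<j$) of $X$; here the rank of a sequence is the least ordinal strictly larger than the ranks of all its strict extensions in the tree. Let $M^r(X)$ be the set of finite multisets on $X$ with the multiset ordering: $m\le_r m'$ iff $m=m'$ or for every $x\in m\setminus(m\cap m')$ there is $y\in m'\setminus(m\cap m')$ with $x<y$; it is a wpo when $X$ is. Let $P+Q$ denote the lexicographic sum (the disjoint union in which every element of $P$ is below every element of $Q$), let $\Gamma_n$ be the antichain with $n$ elements (the disjoint sum of $n$ one-point orders), and let $H=\sum_{n<\omega}\Gamma_n$ be the lexicographic sum of the $\Gamma_n$, in the order of $\omega$. Then $o(H)=h(H)=w(H)=\omega$ and $w(M^r(H))=\omega^{\omega}$. Put $X_1=H+H$ and $X_2=H+\omega$.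 Then $$o(X_1)=o(X_2)=\omega\cdot 2,\qquad h(X_1)=h(X_2)=\omega\cdot 2,\qquad w(X_1)=w(X_2)=\omega,$$ whereas $$w(M^r(X_1))=\omega^{\omega\cdot 2}\qquad\text{and}\qquad w(M^r(X_2))=\omega^{\omega}.$$ Consequently the width of the multiset ordering is not functional in the three invariants: there is no function $F$ on triples of ordinals such that $w(M^r(X))=F(o(X),h(X),w(X))$ for every wpo $X$. -/

import Mathlib

universe u

namespace WPO

/-! ### Rank of the empty sequence in a tree of finite sequences -/

/-- The finite sequences `x₁, …, xₙ` such that `r xᵢ xⱼ` for all `i < j`. -/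
def SeqTree {X : Type u} (r : X → X → Prop) : Type u :=
  {l : List X // l.Pairwise r}

/-- Inverse prefix order: `SeqTree.Below r s t` means that `t` is a strict prefix of `s`. -/
def SeqTree.Below {X : Type u} (r : X → X → Prop) (s t : SeqTree r) : Prop :=
  t.1 <+: s.1 ∧ t.1 ≠ s.1

/-- The empty sequence, the root of the tree. -/
def SeqTree.root {X : Type u} (r : X → X → Prop) : SeqTree r :=
  ⟨[], List.Pairwise.nil⟩

/-- If no infinite sequence satisfies `r` pairwise, the tree is well-founded. -/
theorem SeqTree.wellFounded_below {X : Type u} (r : X → X → Prop)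
    (h : ∀ f : ℕ → X, ∃ i j, i < j ∧ ¬ r (f i) (f j)) :
    WellFounded (SeqTree.Below r) := by
  rw [wellFounded_iff_isEmpty_descending_chain]
  refine ⟨fun ⟨s, hs⟩ => ?_⟩
  have hlt : ∀ n, (s n).1.length < (s (n + 1)).1.length := fun n =>
    lt_of_le_of_ne (hs n).1.length_le fun e => (hs n).2 ((hs n).1.eq_of_length e)
  have hlen : ∀ n, n ≤ (s n).1.length := by
    intro n
    induction n with
    | zero => exact Nat.zero_le _
    | succ k ih => exact lt_of_le_of_lt ih (hlt k)
  have hpre : ∀ m n, m ≤ n → (s m).1 <+: (s n).1 := by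
    intro m n hmn
    induction hmn with
    | refl => exact List.prefix_rfl
    | step _ ih => exact ih.trans (hs _).1
  have hn : ∀ n, n < (s (n + 1)).1.length := fun n => hlen (n + 1)
  obtain ⟨i, j, hij, hr⟩ := h fun n => (s (n + 1)).1[n]'(hn n)
  apply hr
  have hp := hpre (i + 1) (j + 1) (by omega)
  have e : (s (i + 1)).1[i]'(hn i) = (s (j + 1)).1[i]'(lt_of_lt_of_le (hn i) hp.length_le) :=
    hp.getElem (hn i)
  show r ((s (i + 1)).1[i]'(hn i)) _
  rw [e]
  exact List.pairwise_iff_getElem.1 (s (j + 1)).2 i j _ _ hij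

/-! ### The three ordinal invariants of a well partial order

A well partial order is a type with `[PartialOrder X] [WellQuasiOrderedLE X]`: every infinite
sequence `f` has `m < n` with `f m ≤ f n`. -/

/-- The relation between the terms `x`, `y` (in this order) of a bad sequence. -/
def BadRel (X : Type u) [PartialOrder X] (x y : X) : Prop := ¬ x ≤ y

/-- The relation between the terms `x`, `y` (in this order) of a strictly decreasing sequence. -/
def DecRel (X : Type u) [PartialOrder X] (x y : X) : Prop := y < x

/-- The relation between the terms of an antichain: incomparability. -/
def AntRel (X : Type u) [PartialOrder X] (x y : X) : Prop := ¬ x ≤ y ∧ ¬ y ≤ x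

section Invariants

variable (X : Type u) [PartialOrder X] [WellQuasiOrderedLE X]

instance badWellFounded : IsWellFounded (SeqTree (BadRel X)) (SeqTree.Below (BadRel X)) :=
  ⟨SeqTree.wellFounded_below _ fun f => by
    obtain ⟨m, n, hmn, h⟩ := wellQuasiOrdered_le f
    exact ⟨m, n, hmn, fun h' => h' h⟩⟩

instance decWellFounded : IsWellFounded (SeqTree (DecRel X)) (SeqTree.Below (DecRel X)) :=
  ⟨SeqTree.wellFounded_below _ fun f => by
    obtain ⟨m, n, hmn, h⟩ := wellQuasiOrdered_le f
    exact ⟨m, n, hmn, fun h' => not_lt_of_ge h h'⟩⟩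

instance antWellFounded : IsWellFounded (SeqTree (AntRel X)) (SeqTree.Below (AntRel X)) :=
  ⟨SeqTree.wellFounded_below _ fun f => by
    obtain ⟨m, n, hmn, h⟩ := wellQuasiOrdered_le f
    exact ⟨m, n, hmn, fun h' => h'.1 h⟩⟩

/-- The maximal order type `o(X)`: the rank of the empty sequence in the tree of bad sequences. -/
noncomputable def maxOrderType : Ordinal.{u} :=
  IsWellFounded.rank (SeqTree.Below (BadRel X)) (SeqTree.root (BadRel X))

/-- The height `h(X)`: the rank of the empty sequence in the tree of strictly decreasing
sequences. -/
noncomputable def height : Ordinal.{u} :=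
  IsWellFounded.rank (SeqTree.Below (DecRel X)) (SeqTree.root (DecRel X))

/-- The width `w(X)`: the rank of the empty sequence in the tree of antichains. -/
noncomputable def width : Ordinal.{u} :=
  IsWellFounded.rank (SeqTree.Below (AntRel X)) (SeqTree.root (AntRel X))

end Invariants

/-! ### The multiset ordering -/

open Classical in
/-- The multiset ordering: `m ≤ m'` iff `m = m'`, or every element of `m ∖ (m ∩ m')` is strictly
below some element of `m' ∖ (m ∩ m')` (multiset intersection and subtraction). -/
def MultisetLE {X : Type u} [PartialOrder X] (m m' : Multiset X) : Prop :=
  m = m' ∨ ∀ x ∈ m - m ∩ m', ∃ y ∈ m' - m ∩ m', x < y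

theorem multisetLE_iff {X : Type u} [PartialOrder X] {m m' : Multiset X} :
    MultisetLE m m' ↔ m = m' ∨ Multiset.IsDershowitzMannaLT m m' := by
  classical
  unfold MultisetLE
  constructor
  · rintro (h | h)
    · exact Or.inl h
    · have e1 : m = m ∩ m' + (m - m ∩ m') := (add_tsub_cancel_of_le Multiset.inter_le_left).symm
      have e2 : m' = m ∩ m' + (m' - m ∩ m') :=
        (add_tsub_cancel_of_le Multiset.inter_le_right).symm
      by_cases hz : m' - m ∩ m' = 0
      · left
        have hy : m - m ∩ m' = 0 := Multiset.eq_zero_of_forall_notMem fun x hx => by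
          obtain ⟨y, hy, -⟩ := h x hx
          simp [hz] at hy
        rw [e1, hy, ← hz]
        exact e2.symm
      · exact Or.inr ⟨m ∩ m', m - m ∩ m', m' - m ∩ m', hz, e1, e2, h⟩
  · rintro (h | ⟨A, Y, Z, -, rfl, rfl, h⟩)
    · exact Or.inl h
    · right
      intro x hx
      have hxY : x ∈ Y := by
        rw [Multiset.mem_sub, Multiset.count_inter, Multiset.count_add, Multiset.count_add] at hx
        rw [← Multiset.count_pos]
        omega
      obtain ⟨z, hz, hxz⟩ := h x hxY
      obtain ⟨w, hzw, hw⟩ := Z.toFinset.exists_le_maximal (by simpa using hz)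
      have hwZ : w ∈ Z := by simpa using hw.1
      refine ⟨w, ?_, lt_of_lt_of_le hxz hzw⟩
      have hwY : w ∉ Y := fun hwY => by
        obtain ⟨v, hv, hwv⟩ := h w hwY
        exact hw.not_gt (by simpa using hv) hwv
      rw [Multiset.mem_sub, Multiset.count_inter, Multiset.count_add, Multiset.count_add,
        Multiset.count_eq_zero_of_notMem hwY]
      have := Multiset.count_pos.2 hwZ
      omega

theorem MultisetLE.trans {X : Type u} [PartialOrder X] {m₁ m₂ m₃ : Multiset X}
    (h : MultisetLE m₁ m₂) (h' : MultisetLE m₂ m₃) : MultisetLE m₁ m₃ := by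
  rw [multisetLE_iff] at *
  rcases h with rfl | h
  · exact h'
  · rcases h' with rfl | h'
    · exact Or.inr h
    · exact Or.inr (h.trans h')

theorem MultisetLE.antisymm {X : Type u} [PartialOrder X] {m m' : Multiset X}
    (h : MultisetLE m m') (h' : MultisetLE m' m) : m = m' := by
  classical
  rw [multisetLE_iff] at *
  rcases h with rfl | h
  · rfl
  · rcases h' with rfl | h'
    · rfl
    · obtain ⟨A, Y, Z, hZ, e, e', hYZ⟩ := h.trans h'
      obtain rfl : Y = Z := add_left_cancel (e.symm.trans e')
      exfalso
      obtain ⟨x, hx⟩ := Multiset.exists_mem_of_ne_zero hZ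
      obtain ⟨w, -, hw⟩ := Y.toFinset.exists_le_maximal (show x ∈ Y.toFinset by simpa using hx)
      obtain ⟨v, hv, hwv⟩ := hYZ w (by simpa using hw.1)
      exact hw.not_gt (by simpa using hv) hwv

theorem MultisetLE.of_sublistForall₂ {X : Type u} [PartialOrder X] {l l' : List X}
    (h : List.SublistForall₂ (· ≤ ·) l l') :
    MultisetLE (l : Multiset X) (l' : Multiset X) := by
  have hadd : ∀ (a : X) (m m' : Multiset X), MultisetLE m m' → MultisetLE (a ::ₘ m) (a ::ₘ m') := by
    intro a m m' h
    rw [multisetLE_iff] at *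
    rcases h with rfl | ⟨A, Y, Z, hZ, rfl, rfl, h⟩
    · exact Or.inl rfl
    · exact Or.inr ⟨a ::ₘ A, Y, Z, hZ, by simp, by simp, h⟩
  have hnew : ∀ (a : X) (m : Multiset X), MultisetLE m (a ::ₘ m) := by
    intro a m
    rw [multisetLE_iff]
    exact Or.inr ⟨m, 0, {a}, by simp, by simp, by simp [add_comm m], by simp⟩
  have hrep : ∀ (a b : X) (m : Multiset X), a ≤ b → MultisetLE (a ::ₘ m) (b ::ₘ m) := by
    intro a b m hab
    rw [multisetLE_iff]
    rcases hab.eq_or_lt with rfl | hab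
    · exact Or.inl rfl
    · exact Or.inr ⟨m, {a}, {b}, by simp, by simp [add_comm m], by simp [add_comm m], by simpa⟩
  induction h with
  | nil =>
    rename_i l
    induction l with
    | nil => exact Or.inl rfl
    | cons a l ih => exact ih.trans (hnew a _)
  | cons hab _ ih => exact (hadd _ _ _ ih).trans (hrep _ _ _ hab)
  | cons_right _ ih => exact ih.trans (hnew _ _)

/-- `MulR X` is the set of finite multisets on `X` equipped with the multiset ordering
(`Multiset X` itself carries the inclusion order in Mathlib). -/
def MulR (X : Type u) : Type u := Multiset X

instance MulR.instPartialOrder (X : Type u) [PartialOrder X] : PartialOrder (MulR X) where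
  le m m' := MultisetLE (X := X) m m'
  le_refl _ := Or.inl rfl
  le_trans _ _ _ h h' := MultisetLE.trans h h'
  le_antisymm _ _ h h' := MultisetLE.antisymm h h'

instance MulR.instWellQuasiOrderedLE (X : Type u) [PartialOrder X] [WellQuasiOrderedLE X] :
    WellQuasiOrderedLE (MulR X) := by
  refine ⟨fun f => ?_⟩
  have hX : (Set.univ : Set X).PartiallyWellOrderedOn (· ≤ ·) :=
    Set.partiallyWellOrderedOn_univ_iff.2 wellQuasiOrdered_le
  obtain ⟨m, n, hmn, h⟩ :=
    Set.PartiallyWellOrderedOn.partiallyWellOrderedOn_sublistForall₂ (· ≤ ·) hX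
      fun n => ⟨Multiset.toList (α := X) (f n), fun _ _ => Set.mem_univ _⟩
  refine ⟨m, n, hmn, ?_⟩
  have hle := MultisetLE.of_sublistForall₂ h
  have em : (Multiset.toList (α := X) (f m) : Multiset X) = f m := Multiset.coe_toList _
  have en : (Multiset.toList (α := X) (f n) : Multiset X) = f n := Multiset.coe_toList _
  change MultisetLE (X := X) (f m) (f n)
  rw [← em, ← en]
  exact hle

/-! ### Lexicographic sums and the two examples -/

instance sumLexWellQuasiOrderedLE (P Q : Type u) [PartialOrder P] [PartialOrder Q]
    [WellQuasiOrderedLE P] [WellQuasiOrderedLE Q] : WellQuasiOrderedLE (P ⊕ₗ Q) := by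
  have h1 := (Set.isPWO_univ_iff.2 ‹WellQuasiOrderedLE P›).image_of_monotone
    (f := fun p : P => (toLex (Sum.inl p) : P ⊕ₗ Q)) Sum.Lex.inl_mono
  have h2 := (Set.isPWO_univ_iff.2 ‹WellQuasiOrderedLE Q›).image_of_monotone
    (f := fun q : Q => (toLex (Sum.inr q) : P ⊕ₗ Q)) Sum.Lex.inr_mono
  refine Set.isPWO_univ_iff.1 ((h1.union h2).mono ?_)
  rintro (p | q) -
  · exact Or.inl ⟨p, Set.mem_univ _, rfl⟩
  · exact Or.inr ⟨q, Set.mem_univ _, rfl⟩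

instance sigmaLexWellQuasiOrderedLE (A : ℕ → Type u) [∀ n, PartialOrder (A n)]
    [∀ n, WellQuasiOrderedLE (A n)] : WellQuasiOrderedLE (Σₗ n : ℕ, A n) := by
  refine ⟨fun f => ?_⟩
  obtain ⟨g, hg⟩ := (wellQuasiOrdered_le (α := ℕ)).exists_monotone_subseq fun n => (f n).1
  by_cases hc : ∃ n, (f (g 0)).1 < (f (g n)).1
  · obtain ⟨n, hn⟩ := hc
    refine ⟨g 0, g n, g.strictMono (Nat.pos_of_ne_zero ?_), Sigma.Lex.le_def.2 (Or.inl hn)⟩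
    rintro rfl
    exact lt_irrefl _ hn
  · have heq : ∀ n, (f (g n)).1 = (f (g 0)).1 := fun n =>
      le_antisymm (not_lt.1 fun h => hc ⟨n, h⟩) (hg 0 n (Nat.zero_le n))
    obtain ⟨m, n, hmn, h⟩ :=
      wellQuasiOrdered_le fun n => (heq n ▸ (f (g n)).2 : A (f (g 0)).1)
    refine ⟨g m, g n, g.strictMono hmn,
      Sigma.Lex.le_def.2 (Or.inr ⟨(heq m).trans (heq n).symm, ?_⟩)⟩
    have key : ∀ (i j k : ℕ) (hi : i = k) (hj : j = k) (x : A i) (y : A j),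
        (hi ▸ x : A k) ≤ (hj ▸ y : A k) →
          ((hi.trans hj.symm).rec (motive := fun l _ => A l) x : A j) ≤ y := by
      rintro i j k rfl rfl x y h
      exact h
    exact key _ _ _ (heq m) (heq n) _ _ h

/-- `Γ k`: the disjoint sum of `k` singletons (the order on `Σ` compares only elements with the
same index). -/
abbrev Gamma (k : ℕ) : Type := Σ _ : Fin k, Unit

instance gammaWellQuasiOrderedLE (k : ℕ) : WellQuasiOrderedLE (Gamma k) :=
  Finite.to_wellQuasiOrderedLE

/-- `H = Σ_{n < ω} Γ n`, a lexicographic sum. -/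
abbrev H : Type := Σₗ n : ℕ, Gamma n

/-- `X₁ = H + H`, a lexicographic sum. -/
abbrev X₁ : Type := H ⊕ₗ H

/-- `X₂ = H + ω`, a lexicographic sum. -/
abbrev X₂ : Type := H ⊕ₗ ℕ

end WPO

namespace WPO

open Ordinal Set

/-! Once `x` has been played, the rest of the sequence lives among the points still related to `x`.
`RankLE` and `RankGE` bound the rank by recursion on these residual sets, so that the computations
deal with sets of points and not with sequences.

Let every point of `P` be below every point of `Q`, and split a multiset on `P + Q` into its lower
and upper parts. When the upper parts differ, they alone decide the comparison, so incomparability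
is lexicographic with the upper part dominant (`multisetInc_add_iff`). Hence the width of the
multisets on `P + Q` is the product of the two widths, the one for `P` on the left, provided that
this one is a power of `ω` (`RankLE.lex`, `RankGE.lex`; only the upper bound needs the proviso).

In `H`, a multiset incomparable with `m` cannot reach a level above those of `m`. It therefore lives
on a finite set, where the rank is below `ω ^ ω`. Conversely, each level with two incomparable
points contributes a factor `ω`. So `H` gives `ω ^ ω`. Multisets on a linear order are linearly
ordered and have width `1`. Thus `X₁` gives `ω ^ ω * ω ^ ω = ω ^ (ω * 2)`, and `X₂` gives only `ω ^
ω * 1`.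

The three invariants do not see the difference: in `H` and in `ω` every point is below all but
finitely many points, and this, with an infinite chain in each summand and large finite antichains
in the lower one, determines `o`, `h` and `w` of the sums. -/

/-! ### Bounds on ranks of trees of sequences, in terms of sets of available points -/

/-- The tree of sequences with terms in `S`, related pairwise by `r`, has rank at most `a`. -/
def RankLE {X : Type u} (r : X → X → Prop) (a : Ordinal.{u}) (S : Set X) : Prop :=
  ∀ x ∈ S, ∃ b, ∃ _ : b < a, RankLE r b (S ∩ {y | r x y})
termination_by a

/-- The tree of sequences with terms in `S`, related pairwise by `r`, has rank at least `a`. -/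
def RankGE {X : Type u} (r : X → X → Prop) (a : Ordinal.{u}) (S : Set X) : Prop :=
  ∀ b, ∀ _ : b < a, ∃ x ∈ S, RankGE r b (S ∩ {y | r x y})
termination_by a

theorem rankLE_iff {X : Type u} {r : X → X → Prop} {a : Ordinal.{u}} {S : Set X} :
    RankLE r a S ↔ ∀ x ∈ S, ∃ b < a, RankLE r b (S ∩ {y | r x y}) := by
  rw [RankLE]
  simp only [exists_prop]

theorem rankGE_iff {X : Type u} {r : X → X → Prop} {a : Ordinal.{u}} {S : Set X} :
    RankGE r a S ↔ ∀ b < a, ∃ x ∈ S, RankGE r b (S ∩ {y | r x y}) := by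
  rw [RankGE]

/-- Applying `f` termwise sends sequences in `C` to sequences in `A` of the same length and respects
extension, so `f` need not be injective. -/
theorem RankLE.comap {X Z : Type u} {r : X → X → Prop} {r' : Z → Z → Prop} {A : Set X}
    {C : Set Z} {a b : Ordinal.{u}} (h : RankLE r a A) (f : Z → X) (hf : MapsTo f C A)
    (hr : ∀ z ∈ C, ∀ z' ∈ C, r' z z' → r (f z) (f z')) (hab : a ≤ b) : RankLE r' b C := by
  induction a using WellFoundedLT.induction generalizing A C b with
  | ind a ih =>
    rw [rankLE_iff] at h ⊢
    intro z hz
    obtain ⟨c, hc, hA⟩ := h (f z) (hf hz)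
    exact ⟨c, hc.trans_le hab, ih c hc hA (fun z' hz' => ⟨hf hz'.1, hr z hz z' hz'.1 hz'.2⟩)
      (fun z hz z' hz' => hr z hz.1 z' hz'.1) le_rfl⟩

theorem RankLE.mono {X : Type u} {r : X → X → Prop} {S T : Set X} {a b : Ordinal.{u}}
    (h : RankLE r a T) (hST : S ⊆ T) (hab : a ≤ b) : RankLE r b S :=
  h.comap id hST (fun _ _ _ _ h => h) hab

theorem RankGE.map {X Z : Type u} {r : X → X → Prop} {r' : Z → Z → Prop} {A : Set X}
    {C : Set Z} {a b : Ordinal.{u}} (h : RankGE r a A) (f : X → Z) (hf : MapsTo f A C)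
    (hr : ∀ x ∈ A, ∀ x' ∈ A, r x x' → r' (f x) (f x')) (hba : b ≤ a) : RankGE r' b C := by
  induction b using WellFoundedLT.induction generalizing A C a with
  | ind b ih =>
    rw [rankGE_iff] at h ⊢
    intro c hc
    obtain ⟨x, hx, hA⟩ := h c (hc.trans_le hba)
    exact ⟨f x, hf hx, ih c hc hA (fun x' hx' => ⟨hf hx'.1, hr x hx x' hx'.1 hx'.2⟩)
      (fun z hz z' hz' => hr z hz.1 z' hz'.1) le_rfl⟩

theorem RankGE.mono {X : Type u} {r : X → X → Prop} {S T : Set X} {a b : Ordinal.{u}}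
    (h : RankGE r a S) (hST : S ⊆ T) (hba : b ≤ a) : RankGE r b T :=
  h.map id hST (fun _ _ _ _ h => h) hba

theorem RankGE.of_forall_lt {X : Type u} {r : X → X → Prop} {S : Set X} {a : Ordinal.{u}}
    (h : ∀ b < a, ∃ c, b < c ∧ RankGE r c S) : RankGE r a S := by
  rw [rankGE_iff]
  intro b hb
  obtain ⟨c, hbc, hc⟩ := h b hb
  exact rankGE_iff.1 hc b hbc

/-! ### Connection with the ranks of the empty sequence -/

/-- The points that may be added to a sequence. -/
def available {X : Type u} (r : X → X → Prop) (l : List X) : Set X := {y | ∀ x ∈ l, r x y}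

theorem available_append {X : Type u} (r : X → X → Prop) (l : List X) (x : X) :
    available r (l ++ [x]) = available r l ∩ {y | r x y} := by
  ext y
  simp only [available, List.mem_append, List.mem_singleton, mem_ofPred_eq, mem_inter_iff]
  constructor
  · exact fun h => ⟨fun z hz => h z (Or.inl hz), h x (Or.inr rfl)⟩
  · rintro ⟨h, h'⟩ z (hz | rfl)
    exacts [h z hz, h']

theorem pairwise_append_singleton {X : Type u} {r : X → X → Prop} {l : List X} {x : X}
    (hl : l.Pairwise r) (hx : x ∈ available r l) : (l ++ [x]).Pairwise r :=
  List.pairwise_append.2 ⟨hl, List.pairwise_singleton _ _, fun a ha b hb => by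
    rw [List.mem_singleton.1 hb]; exact hx a ha⟩

section Rank

variable {X : Type u} {r : X → X → Prop} [IsWellFounded (SeqTree r) (SeqTree.Below r)]

theorem RankLE.rank_le_of_available {a : Ordinal.{u}} {l : SeqTree r}
    (h : RankLE r a (available r l.1)) : IsWellFounded.rank (SeqTree.Below r) l ≤ a := by
  induction a using WellFoundedLT.induction generalizing l with
  | ind a ih =>
    rw [IsWellFounded.rank_eq]
    refine Ordinal.iSup_le ?_
    rintro ⟨⟨l', hp⟩, ⟨t, ht⟩, hne⟩
    change l.1 ++ t = l' at ht
    subst ht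
    rw [Order.succ_le_iff]
    cases t with
    | nil => simp at hne
    | cons x t =>
      have hx : x ∈ available r l.1 := fun y hy =>
        (List.pairwise_append.1 hp).2.2 y hy x List.mem_cons_self
      obtain ⟨b, hb, hS⟩ := rankLE_iff.1 h x hx
      rw [← available_append] at hS
      have hle := ih b hb (l := ⟨l.1 ++ [x], pairwise_append_singleton l.2 hx⟩) hS
      refine lt_of_le_of_lt (le_trans ?_ hle) hb
      rcases t with _ | ⟨y, t⟩
      · exact le_rfl
      -- The rank ranges over all strict extensions; a longer one lies below the one-step extension
      -- already bounded.
      · refine (IsWellFounded.rank_lt_of_rel ⟨⟨y :: t, by simp⟩, by simp⟩).le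

theorem RankGE.le_rank_of_available {a : Ordinal.{u}} {l : SeqTree r}
    (h : RankGE r a (available r l.1)) : a ≤ IsWellFounded.rank (SeqTree.Below r) l := by
  induction a using WellFoundedLT.induction generalizing l with
  | ind a ih =>
    refine le_of_forall_lt fun b hb => ?_
    obtain ⟨x, hx, hS⟩ := rankGE_iff.1 h b hb
    rw [← available_append] at hS
    refine (ih b hb (l := ⟨l.1 ++ [x], pairwise_append_singleton l.2 hx⟩) hS).trans_lt ?_
    exact IsWellFounded.rank_lt_of_rel ⟨⟨[x], rfl⟩, by simp⟩

theorem RankLE.rank_root_le {a : Ordinal.{u}} (h : RankLE r a univ) :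
    IsWellFounded.rank (SeqTree.Below r) (SeqTree.root r) ≤ a :=
  RankLE.rank_le_of_available (h.mono (subset_univ _) le_rfl)

theorem RankGE.le_rank_root {a : Ordinal.{u}} (h : RankGE r a univ) :
    a ≤ IsWellFounded.rank (SeqTree.Below r) (SeqTree.root r) :=
  RankGE.le_rank_of_available (h.mono (fun _ _ => by simp [available, SeqTree.root]) le_rfl)

end Rank

/-! ### Natural sums of ordinals -/

/-- The natural (Hessenberg) sum of ordinals. -/
noncomputable def natSum (a b : Ordinal.{u}) : Ordinal.{u} :=
  max (⨆ x : Iio a, Order.succ (natSum x.1 b)) (⨆ x : Iio b, Order.succ (natSum a x.1))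
termination_by (a, b)
decreasing_by
  · exact Prod.Lex.left _ _ x.2
  · exact Prod.Lex.right _ x.2

theorem lt_natSum_iff {a b c : Ordinal.{u}} :
    c < natSum a b ↔ (∃ a' < a, c ≤ natSum a' b) ∨ ∃ b' < b, c ≤ natSum a b' := by
  rw [natSum, lt_max_iff, Ordinal.lt_iSup_iff, Ordinal.lt_iSup_iff]
  simp

theorem natSum_lt_left {a a' b : Ordinal.{u}} (h : a' < a) : natSum a' b < natSum a b :=
  lt_natSum_iff.2 (Or.inl ⟨a', h, le_rfl⟩)

theorem natSum_lt_right {a b b' : Ordinal.{u}} (h : b' < b) : natSum a b' < natSum a b :=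
  lt_natSum_iff.2 (Or.inr ⟨b', h, le_rfl⟩)

theorem zero_natSum (b : Ordinal.{u}) : natSum 0 b = b := by
  induction b using WellFoundedLT.induction with
  | ind b ih =>
    refine le_antisymm (le_of_forall_lt fun c hc => ?_) (le_of_forall_lt fun c hc => ?_)
    · rcases lt_natSum_iff.1 hc with ⟨a, ha, -⟩ | ⟨b', hb', h⟩
      · exact absurd ha not_lt_zero
      · exact (h.trans_eq (ih b' hb')).trans_lt hb'
    · exact lt_natSum_iff.2 (Or.inr ⟨c, hc, (ih c hc).ge⟩)

/-- The natural sum adds the `γ`-multiples and the remainders separately; the remainders never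
carry, since `γ` is closed under natural sums. -/
theorem natSum_mul_add_le {γ : Ordinal.{u}} (hγ : ∀ a < γ, ∀ b < γ, natSum a b < γ)
    (m : Ordinal.{u}) (n : ℕ) {a b : Ordinal.{u}} (ha : a < γ) (hb : b < γ) :
    natSum (γ * m + a) (γ * n + b) ≤ γ * (m + n) + natSum a b := by
  have hstep : ∀ k l c : Ordinal.{u}, k < l → c < γ → γ * k + c < γ * l := fun k l c hkl hc =>
    calc γ * k + c < γ * k + γ := by gcongr
      _ = γ * (k + 1) := by rw [mul_add, mul_one]
      _ ≤ γ * l := by gcongr; exact Order.add_one_le_of_lt hkl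
  have key : ∀ x y : Ordinal.{u}, ∀ (m : Ordinal.{u}) (n : ℕ) (a b : Ordinal.{u}), a < γ → b < γ →
      x = γ * m + a → y = γ * n + b → natSum x y ≤ γ * (m + n) + natSum a b := by
    intro x
    induction x using WellFoundedLT.induction with
    | ind x ihx =>
    intro y
    induction y using WellFoundedLT.induction with
    | ind y ihy =>
    intro m n a b ha hb hx hy
    refine le_of_forall_lt fun c hc => ?_
    -- Division by `γ`: anything below `γ * l + d` has quotient and remainder lexicographically
    -- below `(l, d)`.
    have hdec : ∀ (l c d : Ordinal.{u}), c < γ * l + d → d < γ →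
        ∃ k e, e < γ ∧ c = γ * k + e ∧ (k < l ∨ k = l ∧ e < d) := by
      intro l c d hc hd
      have hγ0 : γ ≠ 0 := (zero_le.trans_lt hd).ne'
      rcases lt_or_ge c (γ * l) with h | h
      · obtain ⟨k, hk, e, he, rfl⟩ := lt_mul_iff.1 h
        exact ⟨k, e, he, rfl, Or.inl hk⟩
      · refine ⟨l, c - γ * l, ?_, (Ordinal.add_sub_cancel_of_le h).symm, Or.inr ⟨rfl, ?_⟩⟩
        · refine lt_trans ?_ hd
          rwa [Ordinal.sub_lt_of_le h]
        · rwa [Ordinal.sub_lt_of_le h]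
    rcases lt_natSum_iff.1 hc with ⟨x', hx', h⟩ | ⟨y', hy', h⟩
    · obtain ⟨k, e, he, hk, hlt⟩ := hdec m x' a (hx ▸ hx') ha
      refine (h.trans (ihx x' hx' y k n e b he hb hk hy)).trans_lt ?_
      rcases hlt with hlt | ⟨rfl, hlt⟩
      · refine (hstep _ (m + n) _ ?_ (hγ e he b hb)).trans_le le_self_add
        -- Right addition of `n` is strictly monotone because `n` is finite.
        exact lt_of_not_ge fun h => hlt.not_ge ((Ordinal.add_le_add_iff_right n).1 h)
      · exact (add_lt_add_iff_left _).2 (natSum_lt_left hlt)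
    · obtain ⟨k, e, he, hk, hlt⟩ := hdec n y' b (hy ▸ hy') hb
      obtain ⟨k, rfl⟩ : ∃ k' : ℕ, k = k' := by
        refine lt_omega0.1 (lt_of_le_of_lt ?_ (natCast_lt_omega0 n))
        rcases hlt with h | h
        exacts [h.le, h.1.le]
      refine (h.trans (ihy y' hy' m k a e ha he hx hk)).trans_lt ?_
      rcases hlt with hlt | ⟨hkn, hlt⟩
      · refine (hstep _ (m + n) _ ?_ (hγ a ha e he)).trans_le le_self_add
        simpa using hlt
      · rw [hkn]
        exact (add_lt_add_iff_left _).2 (natSum_lt_right hlt)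
  exact key _ _ m n a b ha hb rfl rfl

/-- Both ordinals lie below finite multiples of a common `ω ^ c` with `c < e`, to which
`natSum_mul_add_le` applies by induction. -/
theorem natSum_lt_omega0_opow (e : Ordinal.{u}) :
    ∀ a < ω ^ e, ∀ b < ω ^ e, natSum a b < ω ^ e := by
  induction e using WellFoundedLT.induction with
  | ind e ih =>
    intro a ha b hb
    rcases eq_or_ne e 0 with rfl | he
    · rw [opow_zero, Order.lt_one_iff] at *
      rw [ha, hb, zero_natSum]
    · obtain ⟨c, hc, n, hn⟩ := (lt_omega0_opow he).1 ha
      obtain ⟨d, hd, m, hm⟩ := (lt_omega0_opow he).1 hb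
      have hcd : max c d < e := max_lt hc hd
      have h1 : a < ω ^ (max c d) * n :=
        hn.trans_le (mul_le_mul_left (opow_le_opow_right omega0_pos (le_max_left _ _)) _)
      have h2 : b < ω ^ (max c d) * m :=
        hm.trans_le (mul_le_mul_left (opow_le_opow_right omega0_pos (le_max_right _ _)) _)
      obtain ⟨k, hk, a', ha', rfl⟩ := lt_mul_iff.1 h1
      obtain ⟨l, hl, b', hb', rfl⟩ := lt_mul_iff.1 h2
      obtain ⟨k, rfl⟩ := lt_omega0.1 (hk.trans (natCast_lt_omega0 n))
      obtain ⟨l, rfl⟩ := lt_omega0.1 (hl.trans (natCast_lt_omega0 m))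
      refine (natSum_mul_add_le (ih _ hcd) k l ha' hb').trans_lt ?_
      refine (lt_omega0_opow he).2 ⟨_, hcd, k + l + 1, ?_⟩
      rw [Nat.cast_succ, Nat.cast_add, mul_add _ _ (1 : Ordinal), mul_one]
      exact (add_lt_add_iff_left _).2 (ih _ hcd _ ha' _ hb')

/-! ### Unions and lexicographic products -/

theorem rankLE_empty {X : Type u} (r : X → X → Prop) (a : Ordinal.{u}) : RankLE r a ∅ :=
  rankLE_iff.2 fun _ h => h.elim

/-- A sequence in the union interleaves one in `S` with one in `T`, and each term lowers one of the
two ranks. -/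
theorem RankLE.union {X : Type u} {r : X → X → Prop} {S T : Set X} {a b : Ordinal.{u}}
    (hS : RankLE r a S) (hT : RankLE r b T) : RankLE r (natSum a b) (S ∪ T) := by
  induction a using WellFoundedLT.induction generalizing S T b with
  | ind a iha =>
  induction b using WellFoundedLT.induction generalizing S T with
  | ind b ihb =>
    rw [rankLE_iff]
    rintro x (hx | hx)
    · obtain ⟨a', ha', h⟩ := rankLE_iff.1 hS x hx
      refine ⟨_, natSum_lt_left ha', ?_⟩
      rw [union_inter_distrib_right]
      exact iha a' ha' h (hT.mono inter_subset_left le_rfl)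
    · obtain ⟨b', hb', h⟩ := rankLE_iff.1 hT x hx
      refine ⟨_, natSum_lt_right hb', ?_⟩
      rw [union_inter_distrib_right]
      exact ihb b' hb' (hS.mono inter_subset_left le_rfl) h

theorem RankLE.biUnion_finset {X : Type u} {ι : Type*} {r : X → X → Prop} {e : Ordinal.{u}}
    (I : Finset ι) (S : ι → Set X) (h : ∀ i ∈ I, ∃ a < ω ^ e, RankLE r a (S i)) :
    ∃ a < ω ^ e, RankLE r a (⋃ i ∈ I, S i) := by
  classical
  induction I using Finset.induction_on with
  | empty => exact ⟨0, opow_pos _ omega0_pos, by simpa using rankLE_empty r 0⟩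
  | insert i I _ ih =>
    obtain ⟨a, ha, h1⟩ := h i (Finset.mem_insert_self _ _)
    obtain ⟨b, hb, h2⟩ := ih fun j hj => h j (Finset.mem_insert_of_mem hj)
    refine ⟨_, natSum_lt_omega0_opow e a ha b hb, ?_⟩
    rw [Finset.set_biUnion_insert]
    exact h1.union h2

/-- After `z`, the available points either move on in the second coordinate (rank at most `ω ^ e *
β'`) or share that of `z` (rank at most `α' < ω ^ e`). The natural sum of these bounds is at most `ω
^ e * β' + α'` because `ω ^ e` is closed under natural sums. -/
theorem RankLE.lex {X Y Z : Type u} {rX : X → X → Prop} {rY : Y → Y → Prop} {rZ : Z → Z → Prop}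
    {A : Set X} {B : Set Y} {C : Set Z} {e β : Ordinal.{u}} (hA : RankLE rX (ω ^ e) A)
    (hB : RankLE rY β B) (hY : ∀ y, ¬ rY y y) (f : Z → X) (g : Z → Y) (hf : MapsTo f C A) (hg : MapsTo g C B)
    (hr : ∀ z ∈ C, ∀ z' ∈ C, rZ z z' → rY (g z) (g z') ∨ g z = g z' ∧ rX (f z) (f z')) :
    RankLE rZ (ω ^ e * β) C := by
  induction β using WellFoundedLT.induction generalizing B C with
  | ind β ih =>
    rw [rankLE_iff]
    intro z hz
    obtain ⟨β', hβ', h2⟩ := rankLE_iff.1 hB _ (hg hz)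
    obtain ⟨α', hα', h1⟩ := rankLE_iff.1 hA _ (hf hz)
    have hC1 : RankLE rZ (ω ^ e * β') {z' | z' ∈ C ∧ rY (g z) (g z')} :=
      ih β' hβ' h2 (fun z' h => hf h.1) (fun z' h => ⟨hg h.1, h.2⟩)
        fun z hz z' hz' => hr z hz.1 z' hz'.1
    have hC2 : RankLE rZ α' {z' | z' ∈ C ∧ rZ z z' ∧ g z = g z' ∧ rX (f z) (f z') } := by
      refine h1.comap f (fun z' h => ⟨hf h.1, h.2.2.2⟩) (fun z₁ h₁ z₂ h₂ h => ?_) le_rfl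
      rcases hr z₁ h₁.1 z₂ h₂.1 h with h | h
      · rw [← h₁.2.2.1, ← h₂.2.2.1] at h
        exact (hY _ h).elim
      · exact h.2
    refine ⟨natSum (ω ^ e * β' + 0) (ω ^ e * (0 : ℕ) + α'), ?_, ?_⟩
    · refine (natSum_mul_add_le (natSum_lt_omega0_opow e) _ _ (opow_pos _ omega0_pos) hα').trans_lt
        ?_
      rw [zero_natSum]
      exact lt_mul_iff.2 ⟨β', hβ', α', hα', by simp⟩
    · simp only [add_zero, Nat.cast_zero, mul_zero, zero_add]
      refine (hC1.union hC2).mono ?_ le_rfl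
      rintro z' ⟨hz', h⟩
      rcases hr z hz z' hz' h with h' | h'
      exacts [Or.inl ⟨hz', h'⟩, Or.inr ⟨hz', h, h'⟩]

/-- Play in `T` first: no move there removes a point of `S`, so all of `a` remains afterwards. -/
theorem RankGE.union {X : Type u} {r : X → X → Prop} {S T : Set X} {a b : Ordinal.{u}}
    (hS : RankGE r a S) (hT : RankGE r b T) (h : ∀ t ∈ T, ∀ s ∈ S, r t s) :
    RankGE r (a + b) (S ∪ T) := by
  induction b using WellFoundedLT.induction generalizing T with
  | ind b ih =>
    rw [rankGE_iff]
    intro c hc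
    rcases lt_or_ge c a with hca | hca
    · exact rankGE_iff.1 (hS.mono subset_union_left le_rfl) c hca
    · obtain ⟨c, rfl⟩ := exists_add_of_le hca
      have hcb : c < b := (add_lt_add_iff_left a).1 hc
      obtain ⟨t, ht, hc'⟩ := rankGE_iff.1 hT c hcb
      refine ⟨t, Or.inr ht, (ih c hcb hc' fun t ht s hs => h t ht.1 s hs).mono ?_ le_rfl⟩
      rintro y (hy | hy)
      · exact ⟨Or.inl hy, h t ht y hy⟩
      · exact ⟨Or.inr hy.1, hy.2⟩

theorem RankGE.lex {X Y Z : Type u} {rX : X → X → Prop} {rY : Y → Y → Prop} {rZ : Z → Z → Prop}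
    {A : Set X} {B : Set Y} {C : Set Z} {α β : Ordinal.{u}} (hA : RankGE rX α A)
    (hB : RankGE rY β B) (f : X → Y → Z) (hf : ∀ x ∈ A, ∀ y ∈ B, f x y ∈ C)
    (hr : ∀ x ∈ A, ∀ x' ∈ A, ∀ y ∈ B, ∀ y' ∈ B, rY y y' ∨ y = y' ∧ rX x x' →
      rZ (f x y) (f x' y')) : RankGE rZ (α * β) C := by
  suffices h : RankGE rZ (α * β) {z | ∃ x ∈ A, ∃ y ∈ B, f x y = z} by
    refine h.mono ?_ le_rfl
    rintro _ ⟨x, hx, y, hy, rfl⟩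
    exact hf x hx y hy
  clear hf
  induction β using WellFoundedLT.induction generalizing B with
  | ind β ih =>
    rw [rankGE_iff]
    intro c hc
    -- To retain rank `α * β' + α'`, use up the fibre over `y`, worth `α'`, before moving on to
    -- other second coordinates, worth `α * β'`.
    obtain ⟨β', hβ', α', hα', rfl⟩ := lt_mul_iff.1 hc
    obtain ⟨y, hy, hB'⟩ := rankGE_iff.1 hB β' hβ'
    obtain ⟨x, hx, hA'⟩ := rankGE_iff.1 hA α' hα'
    refine ⟨f x y, ⟨x, hx, y, hy, rfl⟩, ?_⟩
    have h1 := ih β' hβ' hB' fun x hx x' hx' y hy y' hy' => hr x hx x' hx' y hy.1 y' hy'.1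
    have h2 : RankGE rZ α' {z | ∃ x' ∈ A ∩ {x' | rX x x'}, f x' y = z} :=
      hA'.map (fun x' => f x' y) (fun x' hx' => ⟨x', hx', rfl⟩)
        (fun x₁ h₁ x₂ h₂ h => hr x₁ h₁.1 x₂ h₂.1 y hy y hy (Or.inr ⟨rfl, h⟩)) le_rfl
    refine (h1.union h2 ?_).mono ?_ le_rfl
    · rintro _ ⟨x₁, h₁, rfl⟩ _ ⟨x₂, h₂, y₂, hy₂, rfl⟩
      exact hr x₁ h₁.1 x₂ h₂ y hy y₂ hy₂.1 (Or.inl hy₂.2)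
    · rintro _ (⟨x₂, h₂, y₂, hy₂, rfl⟩ | ⟨x₁, h₁, rfl⟩)
      · exact ⟨⟨x₂, h₂, y₂, hy₂.1, rfl⟩, hr x hx x₂ h₂ y hy y₂ hy₂.1 (Or.inl hy₂.2)⟩
      · exact ⟨⟨x₁, h₁.1, y, hy, rfl⟩, hr x hx x₁ h₁.1 y hy y hy (Or.inr ⟨rfl, h₁.2⟩)⟩

/-! ### Finite sets and sequences -/

theorem rankLE_finset {X : Type u} {r : X → X → Prop} (hr : ∀ x, ¬ r x x) (F : Finset X) :
    RankLE r F.card (F : Set X) := by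
  classical
  induction F using Finset.strongInduction with
  | H F ih =>
    rw [rankLE_iff]
    intro x hx
    refine ⟨(F.erase x).card, ?_, (ih _ (Finset.erase_ssubset hx)).mono ?_ le_rfl⟩
    · exact_mod_cast Finset.card_erase_lt_of_mem hx
    · rintro y ⟨hy, hxy⟩
      refine Finset.mem_coe.2 (Finset.mem_erase.2 ⟨?_, hy⟩)
      rintro rfl
      exact hr _ hxy

theorem exists_rankLE_of_finite {X : Type u} {r : X → X → Prop} (hr : ∀ x, ¬ r x x) {S : Set X}
    (hS : S.Finite) : ∃ a < ω, RankLE r a S :=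
  ⟨_, natCast_lt_omega0 _, by simpa using rankLE_finset hr hS.toFinset⟩

/-- If every point has finitely many successors, the rank is at most `ω`. -/
theorem rankLE_omega0 {X : Type u} {r : X → X → Prop} (hr : ∀ x, ¬ r x x) {S : Set X}
    (h : ∀ x ∈ S, (S ∩ {y | r x y}).Finite) : RankLE r ω S :=
  rankLE_iff.2 fun x hx => exists_rankLE_of_finite hr (h x hx)

/-- At most `F.card` terms come from `F` before the first term from `S`, and after that one only
finitely many points remain. -/
theorem rankLE_omega0_union_finset {X : Type u} {r : X → X → Prop} (hr : ∀ x, ¬ r x x)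
    {S : Set X} (h : ∀ x ∈ S, {y | r x y}.Finite) (F : Finset X) :
    RankLE r (ω + F.card) (S ∪ F) := by
  classical
  induction F using Finset.strongInduction with
  | H F ih =>
    rw [rankLE_iff]
    rintro x (hx | hx)
    · obtain ⟨a, ha, hS⟩ := exists_rankLE_of_finite hr (h x hx)
      exact ⟨a, ha.trans_le le_self_add, hS.mono inter_subset_right le_rfl⟩
    · refine ⟨ω + (F.erase x).card, ?_, (ih _ (Finset.erase_ssubset hx)).mono ?_ le_rfl⟩
      · rw [add_lt_add_iff_left]
        exact_mod_cast Finset.card_erase_lt_of_mem hx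
      · rintro y ⟨hy | hy, hxy⟩
        · exact Or.inl hy
        · refine Or.inr (Finset.mem_coe.2 (Finset.mem_erase.2 ⟨?_, hy⟩))
          rintro rfl
          exact hr _ hxy

theorem rankGE_nat {X : Type u} {r : X → X → Prop} (f : ℕ → X) (k : ℕ)
    (h : ∀ i j, i < j → j < k → r (f j) (f i)) : RankGE r k (f '' Iio k) := by
  induction k using Nat.strong_induction_on with
  | _ k ih =>
    rw [rankGE_iff]
    intro b hb
    obtain ⟨m, rfl⟩ := lt_omega0.1 (hb.trans (natCast_lt_omega0 k))
    have hm : m < k := by exact_mod_cast hb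
    refine ⟨f m, ⟨m, hm, rfl⟩, (ih m hm fun i j hij hj => h i j hij (hj.trans hm)).mono ?_ le_rfl⟩
    rintro _ ⟨i, hi, rfl⟩
    exact ⟨⟨i, lt_trans hi hm, rfl⟩, h i m hi hm⟩

theorem rankGE_omega0 {X : Type u} {r : X → X → Prop} {S : Set X}
    (h : ∀ n : ℕ, RankGE r n S) : RankGE r ω S :=
  RankGE.of_forall_lt fun b hb => by
    obtain ⟨n, rfl⟩ := lt_omega0.1 hb
    exact ⟨_, by exact_mod_cast n.lt_succ_self, h (n + 1)⟩

/-! ### Antichains of multisets -/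

/-- Incomparability for the multiset ordering. -/
def MultisetInc {X : Type u} [PartialOrder X] (m m' : Multiset X) : Prop :=
  ¬ MultisetLE m m' ∧ ¬ MultisetLE m' m

theorem not_multisetInc_self {X : Type u} [PartialOrder X] (m : Multiset X) :
    ¬ MultisetInc m m := fun h => h.1 (Or.inl rfl)

theorem multisetLE_iff_sub {X : Type u} [PartialOrder X] [inst : DecidableEq X]
    {m m' : Multiset X} :
    MultisetLE m m' ↔ m = m' ∨ ∀ x ∈ m - m', ∃ y ∈ m' - m, x < y := by
  obtain rfl : inst = fun a b => Classical.propDecidable (a = b) := Subsingleton.elim _ _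
  let _ : DecidableEq X := fun a b => Classical.propDecidable (a = b)
  unfold MultisetLE
  rw [Multiset.sub_inter, Multiset.inter_comm, Multiset.sub_inter]

theorem multisetLE_of_le {X : Type u} [PartialOrder X] {m m' : Multiset X} (h : m ≤ m') :
    MultisetLE m m' := by
  classical
  rw [multisetLE_iff_sub, tsub_eq_zero_of_le h]
  exact Or.inr fun x hx => (Multiset.notMem_zero x hx).elim

theorem multisetLE_map_iff {X Y : Type u} [PartialOrder X] [PartialOrder Y] (e : X ↪o Y)
    {m m' : Multiset X} : MultisetLE (m.map e) (m'.map e) ↔ MultisetLE m m' := by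
  classical
  have hsub : ∀ s t : Multiset X, s.map e - t.map e = (s - t).map e := by
    intro s t
    ext y
    by_cases hy : ∃ x, e x = y
    · obtain ⟨x, rfl⟩ := hy
      simp only [Multiset.count_sub, Multiset.count_map_eq_count' _ _ e.injective]
    · have : ∀ s : Multiset X, Multiset.count y (s.map e) = 0 := fun s =>
        Multiset.count_eq_zero.2 fun h => by
          obtain ⟨x, -, hx⟩ := Multiset.mem_map.1 h
          exact hy ⟨x, hx⟩
      simp only [Multiset.count_sub, this]
  rw [multisetLE_iff_sub, multisetLE_iff_sub, (Multiset.map_injective e.injective).eq_iff, hsub,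
    hsub]
  simp

theorem multisetInc_map_iff {X Y : Type u} [PartialOrder X] [PartialOrder Y] (e : X ↪o Y)
    {m m' : Multiset X} : MultisetInc (m.map e) (m'.map e) ↔ MultisetInc m m' := by
  simp only [MultisetInc, multisetLE_map_iff]

/-- When `q ≠ q'`, any element of `q' - q` dominates everything in the lower parts, which therefore
play no role. -/
theorem multisetLE_add_iff {X : Type u} [PartialOrder X] {p p' q q' : Multiset X}
    (h : ∀ x ∈ p + p', ∀ y ∈ q + q', x < y) :
    MultisetLE (p + q) (p' + q') ↔ q ≠ q' ∧ MultisetLE q q' ∨ q = q' ∧ MultisetLE p p' := by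
  classical
  have hsub : ∀ p p' q q' : Multiset X, (∀ x ∈ p + p', ∀ y ∈ q + q', x < y) →
      p + q - (p' + q') = (p - p') + (q - q') := by
    intro p p' q q' h
    ext x
    simp only [Multiset.count_sub, Multiset.count_add]
    by_cases hx : x ∈ p + p'
    · have hx' : x ∉ q + q' := fun hx' => lt_irrefl _ (h x hx x hx')
      rw [← Multiset.count_eq_zero, Multiset.count_add] at hx'
      omega
    · rw [← Multiset.count_eq_zero, Multiset.count_add] at hx
      omega
  by_cases hq : q = q'
  · subst hq
    simp only [ne_eq, not_true_eq_false, false_and, true_and, false_or]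
    rw [multisetLE_iff_sub, multisetLE_iff_sub, add_tsub_add_eq_tsub_right,
      add_tsub_add_eq_tsub_right, add_left_inj]
  · simp only [ne_eq, hq, not_false_eq_true, true_and, false_and, or_false]
    have hne : p + q ≠ p' + q' := by
      intro heq
      have h1 : (p - p') + (q - q') = 0 := by rw [← hsub p p' q q' h, heq, tsub_self]
      have h2 : (p' - p) + (q' - q) = 0 := by
        rw [← hsub p' p q' q (by rwa [add_comm p', add_comm q']), heq, tsub_self]
      rw [add_eq_zero] at h1 h2
      exact hq (le_antisymm (tsub_eq_zero_iff_le.1 h1.2) (tsub_eq_zero_iff_le.1 h2.2))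
    rw [multisetLE_iff_sub, multisetLE_iff_sub, hsub p p' q q' h,
      hsub p' p q' q (by rwa [add_comm p', add_comm q'])]
    simp only [hne, hq, false_or, Multiset.mem_add]
    constructor
    · intro H x hx
      obtain ⟨y, hy | hy, hxy⟩ := H x (Or.inr hx)
      · refine absurd hxy (h y ?_ x ?_).asymm
        · exact Multiset.mem_add.2 (Or.inr (Multiset.mem_of_le tsub_le_self hy))
        · exact Multiset.mem_add.2 (Or.inl (Multiset.mem_of_le tsub_le_self hx))
      · exact ⟨y, hy, hxy⟩
    · rintro H x (hx | hx)
      · obtain ⟨y, hy⟩ : ∃ y, y ∈ q' - q := by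
          -- If `q' - q` were empty, `H` would force `q - q'` to be empty too, hence `q = q'`.
          refine Multiset.exists_mem_of_ne_zero fun h0 => hq ?_
          refine le_antisymm (tsub_eq_zero_iff_le.1 ?_) (tsub_eq_zero_iff_le.1 h0)
          refine Multiset.eq_zero_of_forall_notMem fun x hx => ?_
          obtain ⟨y, hy, -⟩ := H x hx
          exact Multiset.notMem_zero y (h0 ▸ hy)
        refine ⟨y, Or.inr hy, h x ?_ y ?_⟩
        · exact Multiset.mem_add.2 (Or.inl (Multiset.mem_of_le tsub_le_self hx))
        · exact Multiset.mem_add.2 (Or.inr (Multiset.mem_of_le tsub_le_self hy))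
      · obtain ⟨y, hy, hxy⟩ := H x hx
        exact ⟨y, Or.inr hy, hxy⟩

theorem multisetInc_add_iff {X : Type u} [PartialOrder X] {p p' q q' : Multiset X}
    (h : ∀ x ∈ p + p', ∀ y ∈ q + q', x < y) :
    MultisetInc (p + q) (p' + q') ↔ MultisetInc q q' ∨ q = q' ∧ MultisetInc p p' := by
  have h' : ∀ x ∈ p' + p, ∀ y ∈ q' + q, x < y := by rwa [add_comm p', add_comm q']
  simp only [MultisetInc, multisetLE_add_iff h, multisetLE_add_iff h']
  by_cases hq : q = q'
  · subst hq
    simp [show MultisetLE q q from Or.inl rfl]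
  · simp [hq, Ne.symm hq]

/-! ### Multisets on a lexicographic sum -/

/-- The multisets with elements in `s`. -/
def multisetsOn {X : Type u} (s : Set X) : Set (Multiset X) := {m | ∀ x ∈ m, x ∈ s}

theorem multisetsOn_univ {X : Type u} : multisetsOn (univ : Set X) = Set.univ :=
  eq_univ_of_forall fun _ _ _ => mem_univ _

theorem add_mem_multisetsOn {X : Type u} {s t : Set X} {p q : Multiset X}
    (hp : p ∈ multisetsOn s) (hq : q ∈ multisetsOn t) : p + q ∈ multisetsOn (s ∪ t) := by
  intro x hx
  rcases Multiset.mem_add.1 hx with hx | hx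
  exacts [Or.inl (hp x hx), Or.inr (hq x hx)]

section Lex

variable {X : Type u} [PartialOrder X] {s t : Set X}

theorem multisetInc_add_iff_of_mem (hst : ∀ x ∈ s, ∀ y ∈ t, x < y) {p p' q q' : Multiset X}
    (hp : p ∈ multisetsOn s) (hp' : p' ∈ multisetsOn s) (hq : q ∈ multisetsOn t)
    (hq' : q' ∈ multisetsOn t) :
    MultisetInc (p + q) (p' + q') ↔ MultisetInc q q' ∨ q = q' ∧ MultisetInc p p' :=
  multisetInc_add_iff fun x hx y hy =>
    hst x ((Multiset.mem_add.1 hx).elim (hp x) (hp' x)) y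
      ((Multiset.mem_add.1 hy).elim (hq y) (hq' y))

theorem rankLE_multisetsOn_union (hst : ∀ x ∈ s, ∀ y ∈ t, x < y) {e β : Ordinal.{u}}
    (hs : RankLE MultisetInc (ω ^ e) (multisetsOn s)) (ht : RankLE MultisetInc β (multisetsOn t)) :
    RankLE MultisetInc (ω ^ e * β) (multisetsOn (s ∪ t)) := by
  classical
  have hf : MapsTo (Multiset.filter (· ∈ s)) (multisetsOn (s ∪ t)) (multisetsOn s) :=
    fun m _ x hx => (Multiset.mem_filter.1 hx).2
  have hg : MapsTo (Multiset.filter (¬ · ∈ s)) (multisetsOn (s ∪ t)) (multisetsOn t) :=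
    fun m hm x hx => (hm x (Multiset.mem_filter.1 hx).1).resolve_left (Multiset.mem_filter.1 hx).2
  refine hs.lex ht not_multisetInc_self _ _ hf hg fun m hm m' hm' h => ?_
  rw [← Multiset.filter_add_not (· ∈ s) m, ← Multiset.filter_add_not (· ∈ s) m'] at h
  exact (multisetInc_add_iff_of_mem hst (hf hm) (hf hm') (hg hm) (hg hm')).1 h

theorem rankGE_multisetsOn_union (hst : ∀ x ∈ s, ∀ y ∈ t, x < y) {α β : Ordinal.{u}}
    (hs : RankGE MultisetInc α (multisetsOn s)) (ht : RankGE MultisetInc β (multisetsOn t)) :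
    RankGE MultisetInc (α * β) (multisetsOn (s ∪ t)) :=
  hs.lex ht (· + ·) (fun _ hp _ hq => add_mem_multisetsOn hp hq)
    fun _ hp _ hp' _ hq _ hq' h => (multisetInc_add_iff_of_mem hst hp hp' hq hq').2 h

end Lex

theorem rankLE_multisetsOn_range {X Y : Type u} [PartialOrder X] [PartialOrder Y] (e : X ↪o Y)
    {a : Ordinal.{u}} (h : RankLE MultisetInc a (univ : Set (Multiset X))) :
    RankLE MultisetInc a (multisetsOn (range e)) := by
  have hsurj : ∀ m ∈ multisetsOn (range e), ∃ n : Multiset X, n.map e = m := by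
    intro m
    induction m using Multiset.induction_on with
    | empty => exact fun _ => ⟨0, rfl⟩
    | cons y m ih =>
      intro hm
      obtain ⟨x, rfl⟩ := hm y (Multiset.mem_cons_self _ _)
      obtain ⟨n, rfl⟩ := ih fun z hz => hm z (Multiset.mem_cons_of_mem hz)
      exact ⟨x ::ₘ n, Multiset.map_cons _ _ _⟩
  choose! g hg using hsurj
  refine h.comap g (mapsTo_univ _ _) (fun m hm m' hm' hmm' => ?_) le_rfl
  rwa [← multisetInc_map_iff e, hg m hm, hg m' hm']

theorem rankGE_multisetsOn_range {X Y : Type u} [PartialOrder X] [PartialOrder Y] (e : X ↪o Y)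
    {a : Ordinal.{u}} (h : RankGE MultisetInc a (univ : Set (Multiset X))) :
    RankGE MultisetInc a (multisetsOn (range e)) :=
  h.map (Multiset.map e)
    (fun m _ y hy => by obtain ⟨x, -, rfl⟩ := Multiset.mem_map.1 hy; exact mem_range_self x)
    (fun _ _ _ _ h => (multisetInc_map_iff e).2 h) le_rfl

/-! ### Multisets on two incomparable points, on finite sets and on linear orders -/

/-- Two incomparable points already give infinite width. -/
theorem rankGE_multisetsOn_pair {X : Type u} [PartialOrder X] {s : Set X} {a b : X} (ha : a ∈ s)
    (hb : b ∈ s) (hab : ¬ a ≤ b) (hba : ¬ b ≤ a) :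
    RankGE MultisetInc ω (multisetsOn s) := by
  classical
  have hne : a ≠ b := fun h => hab h.le
  -- The multisets with `i` copies of `a` and `k - i` copies of `b`, for `i < k`, form an antichain:
  -- of two of them, one has only extra `a`s and the other only extra `b`s.
  have key : ∀ k i j : ℕ, i < k → j < k → i ≠ j →
      ¬ MultisetLE (Multiset.replicate i a + Multiset.replicate (k - i) b)
        (Multiset.replicate j a + Multiset.replicate (k - j) b) := by
    intro k i j hi hj hij h
    rw [multisetLE_iff_sub] at h
    have hcount : ∀ i, Multiset.count a (Multiset.replicate i a + Multiset.replicate (k - i) b) = i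
        ∧ Multiset.count b (Multiset.replicate i a + Multiset.replicate (k - i) b) = k - i := by
      intro i
      simp [Multiset.count_replicate, hne, hne.symm]
    rcases h with h | h
    · apply hij
      rw [← (hcount i).1, h, (hcount j).1]
    · have hmem : ∀ i j, ∀ y ∈ (Multiset.replicate i a + Multiset.replicate (k - i) b) -
          (Multiset.replicate j a + Multiset.replicate (k - j) b), y = a ∨ y = b := by
        intro i j y hy
        rcases Multiset.mem_add.1 (Multiset.mem_of_le tsub_le_self hy) with h | h
        exacts [Or.inl (Multiset.eq_of_mem_replicate h), Or.inr (Multiset.eq_of_mem_replicate h)]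
      rcases lt_or_gt_of_ne hij with hlt | hlt
      · obtain ⟨y, hy, hlt'⟩ := h b (by
          rw [Multiset.mem_sub, (hcount i).2, (hcount j).2]; omega)
        rcases hmem _ _ y hy with rfl | rfl
        exacts [hba hlt'.le, lt_irrefl _ hlt']
      · obtain ⟨y, hy, hlt'⟩ := h a (by
          rw [Multiset.mem_sub, (hcount i).1, (hcount j).1]; omega)
        rcases hmem _ _ y hy with rfl | rfl
        exacts [lt_irrefl _ hlt', hab hlt'.le]
  refine rankGE_omega0 fun k => ?_
  refine (rankGE_nat (fun i => Multiset.replicate i a + Multiset.replicate (k - i) b) k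
    fun i j hij hj => ⟨key k j i hj (hij.trans hj) hij.ne', key k i j (hij.trans hj) hj hij.ne⟩).mono
    ?_ le_rfl
  rintro _ ⟨i, -, rfl⟩ x hx
  rcases Multiset.mem_add.1 hx with h | h
  · rwa [Multiset.eq_of_mem_replicate h]
  · rwa [Multiset.eq_of_mem_replicate h]

open Classical in
/-- The multisets whose multiplicities outside of the finite set `F` are given by `c` have, for
inclusion, maximal order type at most `ω ^ #F`. -/
theorem rankLE_multisets_of_count {X : Type u} (F : Finset X) (c : X → ℕ) :
    RankLE (fun m m' : Multiset X => ¬ m ≤ m') (ω ^ (F.card : Ordinal.{u}))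
      {m | ∀ x ∉ F, m.count x = c x} := by
  induction F using Finset.strongInduction generalizing c with
  | H F ih =>
    rw [rankLE_iff]
    intro m hm
    -- A multiset not including `m` has some `x ∈ F` with multiplicity below `m.count x`. Fixing `x`
    -- and that multiplicity gives finitely many classes, each with one free point fewer.
    obtain ⟨a, ha, h⟩ := RankLE.biUnion_finset (r := fun m m' : Multiset X => ¬ m ≤ m')
      (e := F.card) (F.sigma fun x => Finset.range (m.count x))
      (fun i => {m' | ∀ x ∉ F.erase i.1, m'.count x = Function.update c i.1 i.2 x}) (by
        rintro ⟨x, k⟩ hi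
        have hx : x ∈ F := (Finset.mem_sigma.1 hi).1
        refine ⟨_, ?_, ih _ (Finset.erase_ssubset hx) _⟩
        rw [opow_lt_opow_iff_right one_lt_omega0]
        exact_mod_cast Finset.card_erase_lt_of_mem hx)
    refine ⟨a, ha, h.mono ?_ le_rfl⟩
    rintro m' ⟨hm', hmm'⟩
    obtain ⟨x, hx⟩ : ∃ x, m'.count x < m.count x := by
      by_contra! hcon
      exact hmm' (Multiset.le_iff_count.2 hcon)
    have hxF : x ∈ F := by
      by_contra hxF
      rw [hm x hxF, hm' x hxF] at hx
      exact lt_irrefl _ hx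
    refine mem_iUnion₂.2 ⟨⟨x, m'.count x⟩, Finset.mem_sigma.2 ⟨hxF, Finset.mem_range.2 hx⟩, ?_⟩
    intro y hy
    by_cases hyx : y = x
    · subst hyx
      simp
    · rw [Function.update_of_ne hyx]
      exact hm' y fun hyF => hy (Finset.mem_erase.2 ⟨hyx, hyF⟩)

theorem exists_rankLE_multisetsOn_finite {X : Type u} [PartialOrder X] {s : Set X}
    (hs : s.Finite) : ∃ a < ω ^ ω, RankLE MultisetInc a (multisetsOn s) := by
  classical
  refine ⟨ω ^ (hs.toFinset.card : Ordinal.{u}), ?_, (rankLE_multisets_of_count hs.toFinset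
    fun _ => 0).comap id ?_ (fun m _ m' _ h hle => h.1 (multisetLE_of_le hle)) le_rfl⟩
  · rw [opow_lt_opow_iff_right one_lt_omega0]
    exact natCast_lt_omega0 _
  · intro m hm x hx
    exact Multiset.count_eq_zero.2 fun hxm => hx (hs.mem_toFinset.2 (hm x hxm))

/-- The largest elements of the two differences decide; they are distinct because the differences
are disjoint. -/
theorem multisetLE_total {X : Type u} [LinearOrder X] (m m' : Multiset X) :
    MultisetLE m m' ∨ MultisetLE m' m := by
  by_cases h : m - m' = 0
  · exact Or.inl (multisetLE_of_le (tsub_eq_zero_iff_le.1 h))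
  by_cases h' : m' - m = 0
  · exact Or.inr (multisetLE_of_le (tsub_eq_zero_iff_le.1 h'))
  obtain ⟨a, ha, hamax⟩ := (m - m').toFinset.exists_max_image id (by simpa using h)
  obtain ⟨b, hb, hbmax⟩ := (m' - m).toFinset.exists_max_image id (by simpa using h')
  simp only [Multiset.mem_toFinset, id] at ha hb hamax hbmax
  rw [multisetLE_iff_sub, multisetLE_iff_sub]
  rcases lt_trichotomy a b with hab | rfl | hab
  · exact Or.inl (Or.inr fun x hx => ⟨b, hb, (hamax x hx).trans_lt hab⟩)
  · rw [Multiset.mem_sub] at ha hb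
    omega
  · exact Or.inr (Or.inr fun x hx => ⟨a, ha, (hbmax x hx).trans_lt hab⟩)

/-- The bound is `1` and not `0`, as one-term sequences are antichains. -/
theorem rankLE_multisetInc_of_linearOrder {X : Type u} [LinearOrder X] :
    RankLE MultisetInc 1 (univ : Set (Multiset X)) := by
  rw [rankLE_iff]
  refine fun m _ => ⟨0, zero_lt_one, rankLE_iff.2 ?_⟩
  rintro m' ⟨-, h⟩
  exact ((multisetLE_total m m').elim h.1 h.2).elim

/-! ### Orders in which every point is below all but finitely many points -/

section Cofinite

variable {P Q : Type u} [PartialOrder P] [PartialOrder Q]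

theorem rankLE_decRel_of_badRel {a : Ordinal.{u}} (h : RankLE (BadRel P) a univ) :
    RankLE (DecRel P) a univ :=
  h.comap id (mapsTo_univ _ _) (fun _ _ _ _ h => not_le_of_gt h) le_rfl

theorem rankGE_badRel_of_decRel {a : Ordinal.{u}} (h : RankGE (DecRel P) a univ) :
    RankGE (BadRel P) a univ :=
  h.map id (mapsTo_univ _ _) (fun _ _ _ _ h => not_le_of_gt h) le_rfl

theorem not_badRel_self (x : P) : ¬ BadRel P x x := fun h => h le_rfl

theorem not_antRel_self (x : P) : ¬ AntRel P x x := fun h => h.1 le_rfl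

theorem rankLE_badRel_of_cofinite (hP : ∀ x : P, {y | ¬ x ≤ y}.Finite) :
    RankLE (BadRel P) ω univ :=
  rankLE_omega0 not_badRel_self fun x _ => (hP x).subset inter_subset_right

theorem rankLE_antRel_of_cofinite (hP : ∀ x : P, {y | ¬ x ≤ y}.Finite) :
    RankLE (AntRel P) ω univ :=
  rankLE_omega0 not_antRel_self fun x _ => (hP x).subset fun _ h => h.2.1

theorem rankGE_decRel_range {f : ℕ → P} (hf : StrictMono f) : RankGE (DecRel P) ω (range f) :=
  rankGE_omega0 fun k =>
    (rankGE_nat (r := DecRel P) f k fun _ _ hij _ => hf hij).mono (image_subset_range _ _) le_rfl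

/-- Decreasing sequences are bad, so one upper bound for `o` and one lower bound for `h` settle
both. -/
theorem invariants_of_cofinite [WellQuasiOrderedLE P] (hP : ∀ x : P, {y | ¬ x ≤ y}.Finite)
    {f : ℕ → P} (hf : StrictMono f) : maxOrderType P = ω ∧ height P = ω := by
  have hle := rankLE_badRel_of_cofinite hP
  have hge := (rankGE_decRel_range hf).mono (subset_univ _) le_rfl
  exact ⟨hle.rank_root_le.antisymm (rankGE_badRel_of_decRel hge).le_rank_root,
    (rankLE_decRel_of_badRel hle).rank_root_le.antisymm hge.le_rank_root⟩

/-! ### Invariants of lexicographic sums -/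

/-- The embedding of the lower summand of a lexicographic sum. -/
def inlEmbedding (P Q : Type u) [PartialOrder P] [PartialOrder Q] : P ↪o P ⊕ₗ Q :=
  OrderEmbedding.ofMapLEIff (fun p => toLex (Sum.inl p)) fun _ _ => Sum.Lex.inl_le_inl_iff

/-- The embedding of the upper summand of a lexicographic sum. -/
def inrEmbedding (P Q : Type u) [PartialOrder P] [PartialOrder Q] : Q ↪o P ⊕ₗ Q :=
  OrderEmbedding.ofMapLEIff (fun q => toLex (Sum.inr q)) fun _ _ => Sum.Lex.inr_le_inr_iff

theorem inlEmbedding_lt_inrEmbedding (p : P) (q : Q) :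
    inlEmbedding P Q p < inrEmbedding P Q q := Sum.Lex.inl_lt_inr p q

theorem range_inlEmbedding_union_range_inrEmbedding :
    range (inlEmbedding P Q) ∪ range (inrEmbedding P Q) = Set.univ := by
  refine eq_univ_of_forall ?_
  rintro (p | q)
  exacts [Or.inl ⟨p, rfl⟩, Or.inr ⟨q, rfl⟩]

theorem setOf_not_inl_le_subset (p : P) :
    {y | ¬ inlEmbedding P Q p ≤ y} ⊆ inlEmbedding P Q '' {y | ¬ p ≤ y} := by
  rintro (y | y) hy
  · exact ⟨y, fun h => hy ((inlEmbedding P Q).le_iff_le.2 h), rfl⟩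
  · exact (hy (inlEmbedding_lt_inrEmbedding p y).le).elim

theorem setOf_not_inr_le_subset (q : Q) :
    {y | ¬ inrEmbedding P Q q ≤ y} ⊆
      range (inlEmbedding P Q) ∪ inrEmbedding P Q '' {y | ¬ q ≤ y} := by
  rintro (y | y) hy
  · exact Or.inl ⟨y, rfl⟩
  · exact Or.inr ⟨y, fun h => hy ((inrEmbedding P Q).le_iff_le.2 h), rfl⟩

/-- A first term in `P` leaves finitely many points; one in `Q` leaves `P` together with finitely
many points of `Q`. -/
theorem rankLE_badRel_sumLex (hP : ∀ x : P, {y | ¬ x ≤ y}.Finite)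
    (hQ : ∀ x : Q, {y | ¬ x ≤ y}.Finite) : RankLE (BadRel (P ⊕ₗ Q)) (ω + ω) univ := by
  have hinl : ∀ p : P, {y | ¬ inlEmbedding P Q p ≤ y}.Finite := fun p =>
    ((hP p).image _).subset (setOf_not_inl_le_subset p)
  rw [rankLE_iff]
  rintro (p | q) -
  · obtain ⟨a, ha, h⟩ := exists_rankLE_of_finite not_badRel_self (hinl p)
    exact ⟨a, ha.trans_le le_self_add, h.mono inter_subset_right le_rfl⟩
  · have hfin := (hQ q).image (inrEmbedding P Q)
    refine ⟨ω + hfin.toFinset.card, (add_lt_add_iff_left _).2 (natCast_lt_omega0 _),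
      (rankLE_omega0_union_finset not_badRel_self (S := range (inlEmbedding P Q)) ?_ _).mono ?_
        le_rfl⟩
    · rintro _ ⟨p, rfl⟩
      exact hinl p
    · rw [hfin.coe_toFinset]
      exact inter_subset_right.trans (setOf_not_inr_le_subset q)

/-- An antichain cannot meet both summands, so the width does not add up. -/
theorem rankLE_antRel_sumLex (hP : ∀ x : P, {y | ¬ x ≤ y}.Finite)
    (hQ : ∀ x : Q, {y | ¬ x ≤ y}.Finite) : RankLE (AntRel (P ⊕ₗ Q)) ω univ := by
  refine rankLE_omega0 not_antRel_self ?_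
  rintro (p | q) -
  · exact ((hP p).image _).subset fun y hy => setOf_not_inl_le_subset p hy.2.1
  · refine ((hQ q).image (inrEmbedding P Q)).subset fun y hy => ?_
    refine (setOf_not_inr_le_subset q hy.2.1).resolve_left ?_
    rintro ⟨p, rfl⟩
    exact hy.2.2 (inlEmbedding_lt_inrEmbedding p q).le

theorem rankGE_decRel_sumLex {f : ℕ → P} (hf : StrictMono f) {g : ℕ → Q} (hg : StrictMono g) :
    RankGE (DecRel (P ⊕ₗ Q)) (ω + ω) univ := by
  refine ((rankGE_decRel_range ((inlEmbedding P Q).strictMono.comp hf)).union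
    (rankGE_decRel_range ((inrEmbedding P Q).strictMono.comp hg)) ?_).mono (subset_univ _) le_rfl
  rintro _ ⟨i, rfl⟩ _ ⟨j, rfl⟩
  exact inlEmbedding_lt_inrEmbedding _ _

theorem invariants_sumLex_of_cofinite [WellQuasiOrderedLE P] [WellQuasiOrderedLE Q]
    (hP : ∀ x : P, {y | ¬ x ≤ y}.Finite) (hQ : ∀ x : Q, {y | ¬ x ≤ y}.Finite)
    {f : ℕ → P} (hf : StrictMono f) {g : ℕ → Q} (hg : StrictMono g)
    (hw : RankGE (AntRel P) ω univ) :
    maxOrderType (P ⊕ₗ Q) = ω * 2 ∧ height (P ⊕ₗ Q) = ω * 2 ∧ width (P ⊕ₗ Q) = ω := by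
  have h2 : (ω : Ordinal.{u}) * 2 = ω + ω := by
    rw [← one_add_one_eq_two, mul_add, mul_one]
  have hle := rankLE_badRel_sumLex hP hQ
  have hge := rankGE_decRel_sumLex hf hg
  have hw' : RankGE (AntRel (P ⊕ₗ Q)) ω univ :=
    hw.map (inlEmbedding P Q) (mapsTo_univ _ _) (fun x _ y _ h => by
      simpa only [AntRel, OrderEmbedding.le_iff_le] using h) le_rfl
  rw [h2]
  exact ⟨hle.rank_root_le.antisymm (rankGE_badRel_of_decRel hge).le_rank_root,
    (rankLE_decRel_of_badRel hle).rank_root_le.antisymm hge.le_rank_root,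
    (rankLE_antRel_sumLex hP hQ).rank_root_le.antisymm hw'.le_rank_root⟩

/-- `AntRel (MulR P)` unfolds to `MultisetInc`. -/
theorem width_mulR_eq [WellQuasiOrderedLE P] {a : Ordinal.{u}}
    (hle : RankLE MultisetInc a (univ : Set (Multiset P)))
    (hge : RankGE MultisetInc a (univ : Set (Multiset P))) : width (MulR P) = a :=
  le_antisymm (RankLE.rank_root_le (r := AntRel (MulR P)) hle)
    (RankGE.le_rank_root (r := AntRel (MulR P)) hge)

theorem rankLE_multisetInc_sumLex {e β : Ordinal.{u}}
    (hP : RankLE MultisetInc (ω ^ e) (univ : Set (Multiset P)))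
    (hQ : RankLE MultisetInc β (univ : Set (Multiset Q))) :
    RankLE MultisetInc (ω ^ e * β) (univ : Set (Multiset (P ⊕ₗ Q))) := by
  rw [← multisetsOn_univ, ← range_inlEmbedding_union_range_inrEmbedding]
  refine rankLE_multisetsOn_union ?_ (rankLE_multisetsOn_range _ hP) (rankLE_multisetsOn_range _ hQ)
  rintro _ ⟨p, rfl⟩ _ ⟨q, rfl⟩
  exact inlEmbedding_lt_inrEmbedding p q

theorem rankGE_multisetInc_sumLex {α β : Ordinal.{u}}
    (hP : RankGE MultisetInc α (univ : Set (Multiset P)))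
    (hQ : RankGE MultisetInc β (univ : Set (Multiset Q))) :
    RankGE MultisetInc (α * β) (univ : Set (Multiset (P ⊕ₗ Q))) := by
  rw [← multisetsOn_univ, ← range_inlEmbedding_union_range_inrEmbedding]
  refine rankGE_multisetsOn_union ?_ (rankGE_multisetsOn_range _ hP) (rankGE_multisetsOn_range _ hQ)
  rintro _ ⟨p, rfl⟩ _ ⟨q, rfl⟩
  exact inlEmbedding_lt_inrEmbedding p q

end Cofinite

/-! ### The order `H` -/

/-- The `i`-th element of the summand `Γ n` of `H`. -/
def H.mk {n : ℕ} (i : Fin n) : H := toLex ⟨n, i, ()⟩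

/-- The index of the summand of `H` that contains `x`. -/
def H.level (x : H) : ℕ := (ofLex x).1

theorem H.lt_of_level_lt {x y : H} (h : x.level < y.level) : x < y :=
  Sigma.Lex.lt_def.2 (Or.inl h)

theorem H.mk_le_mk_iff {n : ℕ} {i j : Fin n} : H.mk i ≤ H.mk j ↔ i = j := by
  constructor
  · intro h
    rcases Sigma.Lex.le_def.1 h with hlt | ⟨_, hle⟩
    · exact (lt_irrefl n hlt).elim
    · exact (Sigma.le_def.1 hle).1
  · rintro rfl
    exact le_rfl

theorem H.finite_level_le (n : ℕ) : {x : H | x.level ≤ n}.Finite := by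
  refine ((finite_Iic n).biUnion fun k _ => finite_range fun i : Fin k => H.mk i).subset ?_
  rintro ⟨k, i, u⟩ hx
  exact mem_iUnion₂.2 ⟨k, hx, i, rfl⟩

theorem H.finite_not_le (x : H) : {y | ¬ x ≤ y}.Finite :=
  (H.finite_level_le x.level).subset fun _ hy => not_lt.1 fun h => hy (H.lt_of_level_lt h).le

/-- The chain starts at level `1`, since level `0` is empty. -/
theorem H.strictMono_mk_last : StrictMono fun n : ℕ => H.mk (Fin.last n) :=
  fun _ _ h => H.lt_of_level_lt (Nat.succ_lt_succ h)

theorem H.rankGE_antRel : RankGE (AntRel H) ω univ :=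
  rankGE_omega0 fun k => (rankGE_nat (fun i => H.mk (Fin.ofNat (k + 1) i)) k
    fun i j hij hj => by
      have hne : Fin.ofNat (k + 1) i ≠ Fin.ofNat (k + 1) j := by
        simp only [ne_eq, Fin.ext_iff, Fin.val_ofNat]
        rw [Nat.mod_eq_of_lt (by omega), Nat.mod_eq_of_lt (by omega)]
        exact hij.ne
      exact ⟨fun h => hne (H.mk_le_mk_iff.1 h).symm, fun h => hne (H.mk_le_mk_iff.1 h)⟩).mono
    (subset_univ _) le_rfl

theorem H.width_eq : width H = ω :=
  (rankLE_antRel_of_cofinite H.finite_not_le).rank_root_le.antisymm H.rankGE_antRel.le_rank_root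

theorem H.rankLE_multisetInc : RankLE MultisetInc (ω ^ ω) (univ : Set (Multiset H)) := by
  rw [rankLE_iff]
  intro m _
  obtain ⟨n, hn⟩ : ∃ n, ∀ x ∈ m, x.level ≤ n :=
    ⟨(m.map H.level).sup, fun x hx => Multiset.le_sup (Multiset.mem_map_of_mem _ hx)⟩
  obtain ⟨a, ha, h⟩ := exists_rankLE_multisetsOn_finite (H.finite_level_le n)
  refine ⟨a, ha, h.mono ?_ le_rfl⟩
  rintro m' ⟨-, hm'⟩ y hy
  -- A point of `m'` above level `n` would dominate all of `m`, making `m` smaller than `m'`.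
  by_contra hny
  refine hm'.1 (multisetLE_iff.2 (Or.inr ⟨0, m, m', ?_, by simp, by simp, fun x hx => ⟨y, hy, ?_⟩⟩))
  · rintro rfl
    exact Multiset.notMem_zero y hy
  · exact H.lt_of_level_lt ((hn x hx).trans_lt (not_le.1 hny))

/-- Levels `0` and `1` contain no incomparable pair; each level from `2` on multiplies the width by
at least `ω`, hence the shift between exponent and level. -/
theorem H.rankGE_multisetsOn_level_le (n : ℕ) :
    RankGE MultisetInc (ω ^ (n : Ordinal.{0})) (multisetsOn {x : H | x.level ≤ n + 1}) := by
  induction n with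
  | zero =>
    rw [Nat.cast_zero, opow_zero, rankGE_iff]
    intro b hb
    rw [Order.lt_one_iff] at hb
    subst hb
    exact ⟨0, fun x hx => (Multiset.notMem_zero x hx).elim,
      rankGE_iff.2 fun b hb => (not_lt_zero hb).elim⟩
  | succ n ih =>
    have hpair : RankGE MultisetInc ω (multisetsOn {x : H | x.level = n + 2}) :=
      rankGE_multisetsOn_pair (a := H.mk (0 : Fin (n + 2))) (b := H.mk (1 : Fin (n + 2))) rfl rfl
        (by simp [H.mk_le_mk_iff]) (by simp [H.mk_le_mk_iff])
    have hlt : ∀ x ∈ {x : H | x.level ≤ n + 1}, ∀ y ∈ {x : H | x.level = n + 2}, x < y := by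
      intro x hx y hy
      rw [mem_ofPred_eq] at hx hy
      exact H.lt_of_level_lt (by omega)
    have h := rankGE_multisetsOn_union hlt ih hpair
    rw [Nat.cast_succ, opow_add, opow_one]
    refine h.mono ?_ le_rfl
    intro m hm x hx
    rcases hm x hx with h | h
    · exact Nat.le_succ_of_le h
    · exact le_of_eq h

theorem H.rankGE_multisetInc : RankGE MultisetInc (ω ^ ω) (univ : Set (Multiset H)) :=
  RankGE.of_forall_lt fun b hb => by
    obtain ⟨c, hc, hbc⟩ := (lt_opow_of_isSuccLimit omega0_ne_zero isSuccLimit_omega0).1 hb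
    obtain ⟨n, rfl⟩ := lt_omega0.1 hc
    exact ⟨_, hbc, (H.rankGE_multisetsOn_level_le n).mono (subset_univ _) le_rfl⟩

/-! ### The widths of the two multiset orders -/

theorem width_mulR_X₁ : width (MulR X₁) = ω ^ (ω * 2 : Ordinal.{0}) := by
  have h2 : (ω ^ (ω * 2) : Ordinal.{0}) = ω ^ (ω : Ordinal.{0}) * ω ^ (ω : Ordinal.{0}) := by
    rw [← opow_add, ← one_add_one_eq_two, mul_add, mul_one]
  rw [h2]
  exact width_mulR_eq (rankLE_multisetInc_sumLex H.rankLE_multisetInc H.rankLE_multisetInc)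
    (rankGE_multisetInc_sumLex H.rankGE_multisetInc H.rankGE_multisetInc)

theorem width_mulR_X₂ : width (MulR X₂) = ω ^ (ω : Ordinal.{0}) := by
  refine width_mulR_eq ?_ ?_
  · simpa using rankLE_multisetInc_sumLex H.rankLE_multisetInc
      (rankLE_multisetInc_of_linearOrder (X := ℕ))
  -- The lower copy of `H` already attains the bound.
  · exact (rankGE_multisetsOn_range (inlEmbedding H ℕ) H.rankGE_multisetInc).mono (subset_univ _)
      le_rfl

theorem finite_not_nat_le (n : ℕ) : {m : ℕ | ¬ n ≤ m}.Finite :=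
  (finite_Iio n).subset fun _ h => not_le.1 h

end WPO

open Ordinal in
theorem mainTheorem5 :
    -- the invariants of `H` and the width of its multiset ordering
    (WPO.maxOrderType WPO.H = ω ∧ WPO.height WPO.H = ω ∧ WPO.width WPO.H = ω ∧
      WPO.width (WPO.MulR WPO.H) = ω ^ ω) ∧
    -- `X₁` and `X₂` have the same invariants
    (WPO.maxOrderType WPO.X₁ = ω * 2 ∧ WPO.maxOrderType WPO.X₂ = ω * 2) ∧
    (WPO.height WPO.X₁ = ω * 2 ∧ WPO.height WPO.X₂ = ω * 2) ∧
    (WPO.width WPO.X₁ = ω ∧ WPO.width WPO.X₂ = ω) ∧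
    -- but the widths of their multiset orderings differ
    WPO.width (WPO.MulR WPO.X₁) = ω ^ (ω * 2) ∧
    WPO.width (WPO.MulR WPO.X₂) = ω ^ ω ∧
    -- hence this width is not a function of the three invariants
    ¬ ∃ F : Ordinal.{0} → Ordinal.{0} → Ordinal.{0} → Ordinal.{0},
        ∀ (X : Type) [PartialOrder X] [WellQuasiOrderedLE X],
          WPO.width (WPO.MulR X) = F (WPO.maxOrderType X) (WPO.height X) (WPO.width X) := by
  obtain ⟨ho, hh⟩ := WPO.invariants_of_cofinite WPO.H.finite_not_le WPO.H.strictMono_mk_last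
  obtain ⟨ho₁, hh₁, hw₁⟩ := WPO.invariants_sumLex_of_cofinite WPO.H.finite_not_le
    WPO.H.finite_not_le WPO.H.strictMono_mk_last WPO.H.strictMono_mk_last WPO.H.rankGE_antRel
  obtain ⟨ho₂, hh₂, hw₂⟩ := WPO.invariants_sumLex_of_cofinite WPO.H.finite_not_le
    WPO.finite_not_nat_le WPO.H.strictMono_mk_last strictMono_id WPO.H.rankGE_antRel
  refine ⟨⟨ho, hh, WPO.H.width_eq,
    WPO.width_mulR_eq WPO.H.rankLE_multisetInc WPO.H.rankGE_multisetInc⟩, ⟨ho₁, ho₂⟩, ⟨hh₁, hh₂⟩,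
    ⟨hw₁, hw₂⟩, WPO.width_mulR_X₁, WPO.width_mulR_X₂, ?_⟩
  rintro ⟨F, hF⟩
  have h₁ := hF WPO.X₁
  have h₂ := hF WPO.X₂
  rw [WPO.width_mulR_X₁, ho₁, hh₁, hw₁] at h₁
  rw [WPO.width_mulR_X₂, ho₂, hh₂, hw₂, ← h₁] at h₂
  refine absurd h₂ (ne_of_lt ((opow_lt_opow_iff_right one_lt_omega0).2 ?_))
  exact lt_mul_of_one_lt_right omega0_pos one_lt_two
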